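/- **Corollary 1.3.** Let $\mathcal H$ be a complex Hilbert space of functions on a set $X$ in which all point evaluations are bounded, with reproducing kernel $k$ (so $k(\cdot,w)\in\mathcal H$ and $f(w)=\langle f,k(\cdot,w)\rangle$ for all $f\in\mathcal H$, $w\in X$). Let $$\operatorname{Mult}(\mathcal H)=\{\varphi:X\to\mathbb C : \varphi f\in\mathcal H\text{ for all }f\in\mathcal H\},$$ and equip $M_r(\operatorname{Mult}(\mathcal H))$ with the norm of the multiplication operators on $\mathcal H^r$, the Hilbert space direct sum of $r$ copies of $\mathcal H$. Suppose that * $\mathcal H$ is *normalized*: there is $x_0\in X$ with $k(x,x_0)=1$ for all $x\in X$ (so that $1\in\mathcal H$ and $\operatorname{Mult}(\mathcal H)\subset\mathcal H$); * $\mathcal H$ is a *complete Pick space*: for every $r\in\mathbb N$, all finitely many points $z_1,\dots,z_n\in X$ and all $W_1,\dots,W_n\in M_r(\mathbb C)$, if the $nr\times nr$ block matrix $[k(z_i,z_j)(I_{\mathbb C^r}-W_iW_j^*)]_{i,j=1}^n$ is positive semidefinite, then there is $\Phi\in M_r(\operatorname{Mult}(\mathcal H))$ of norm at most $1$ with $\Phi(z_i)=W_i$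 for $i=1,\dots,n$. Let $\rho:\mathcal H\to\mathbb C$ be a non-zero bounded linear functional. Then the following are equivalent: 1. $\rho(\varphi g)=\rho(\varphi)\rho(g)$ for all $\varphi\in\operatorname{Mult}(\mathcal H)$ and all $g\in\mathcal H$; 2. $\rho(fg)=\rho(f)\rho(g)$ for all $f,g\in\mathcal H$ such that $fg\in\mathcal H$. -/

import Mathlib

open scoped ComplexOrder Matrix

namespace PickSpace

section

variable {X : Type*} (H : Type*) [NormedAddCommGroup H] [InnerProductSpace ℂ H] [RKHS ℂ H X ℂ]

/-- The multiplier algebra `Mult(H)`: all functions `φ : X → ℂ` such that `φ f ∈ H` for every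
`f ∈ H`. -/
def Mult : Subalgebra ℂ (X → ℂ) where
  carrier := {φ | ∀ f : H, ∃ g : H, (g : X → ℂ) = φ * f}
  mul_mem' := by
    intro φ ψ hφ hψ f
    obtain ⟨g, hg⟩ := hψ f
    obtain ⟨h, hh⟩ := hφ g
    exact ⟨h, by rw [hh, hg, mul_assoc]⟩
  add_mem' := by
    intro φ ψ hφ hψ f
    obtain ⟨g, hg⟩ := hφ f
    obtain ⟨h, hh⟩ := hψ f
    exact ⟨g + h, by rw [RKHS.coe_add, hg, hh, add_mul]⟩
  algebraMap_mem' := by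
    intro c f
    exact ⟨c • f, by rw [RKHS.coe_smul, Algebra.algebraMap_eq_smul_one, smul_mul_assoc, one_mul]⟩

variable {H}

theorem exists_coe_eq_mul (φ : Mult H) (f : H) : ∃ g : H, (g : X → ℂ) = (φ : X → ℂ) * f := φ.2 f

/-- The product `φ f ∈ H` of a multiplier `φ` and a function `f ∈ H`. -/
noncomputable def mulFun (φ : Mult H) (f : H) : H := (exists_coe_eq_mul φ f).choose

theorem coe_mulFun (φ : Mult H) (f : H) : ⇑(mulFun φ f) = (φ : X → ℂ) * f :=
  (exists_coe_eq_mul φ f).choose_spec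

/-- The multiplication operator `M_φ : H → H`, `f ↦ φ f`, of a multiplier `φ`. -/
noncomputable def mulOp (φ : Mult H) : H →ₗ[ℂ] H where
  toFun := mulFun φ
  map_add' f g := DFunLike.coe_injective <| by
    simp only [RKHS.coe_add, coe_mulFun, mul_add]
  map_smul' c f := DFunLike.coe_injective <| by
    simp only [RingHom.id_apply, RKHS.coe_smul, coe_mulFun, mul_smul_comm]

theorem coe_mulOp (φ : Mult H) (f : H) : ⇑(mulOp φ f) = (φ : X → ℂ) * f :=
  coe_mulFun φ f

/-- A matrix of multipliers `Φ ∈ M_r(Mult(H))` has norm at most `1`: the operator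
`(f_j)_j ↦ (∑ j, Φ_{ij} f_j)_i` is a contraction on the Hilbert space direct sum
of `r` copies of `H`. -/
def IsContractiveMultiplier {r : ℕ} (Φ : Matrix (Fin r) (Fin r) (Mult H)) : Prop :=
  ∀ F : Fin r → H, ∑ i, ‖∑ j, mulOp (Φ i j) (F j)‖ ^ 2 ≤ ∑ j, ‖F j‖ ^ 2

variable (H) [CompleteSpace H]

/-- The scalar reproducing kernel `k(z,w)`, so that `f(w) = ⟨f, k(·,w)⟩` for `f ∈ H`. -/
noncomputable def ker (z w : X) : ℂ := RKHS.kernel H z w 1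

/-- `H` is normalized: there is `x₀` with `k(x,x₀) = 1` for all `x`. -/
def IsNormalized : Prop := ∃ x₀ : X, ∀ x : X, ker H x x₀ = 1

/-- `H` is a complete Pick space: for all `r`, all points `z_1, …, z_n` and all `r × r` matrices
`W_1, …, W_n`, if the block matrix `[k(z_i,z_j) (I - W_i W_j^*)]` is positive (semidefinite), then
some `Φ ∈ M_r(Mult(H))` of norm at most `1` satisfies `Φ(z_i) = W_i` for all `i`. -/
def IsCompletePick : Prop :=
  ∀ (r n : ℕ) (z : Fin n → X) (W : Fin n → Matrix (Fin r) (Fin r) ℂ),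
    (Matrix.of fun p q : Fin n × Fin r =>
      ker H (z p.1) (z q.1) * (1 - W p.1 * (W q.1)ᴴ) p.2 q.2).PosSemidef →
    ∃ Φ : Matrix (Fin r) (Fin r) (Mult H), IsContractiveMultiplier Φ ∧
      ∀ i a b, (Φ a b : X → ℂ) (z i) = W i a b

variable {H}

/-- If `H` is normalized, then `Mult(H) ⊆ H`. -/
theorem exists_coe_eq_mult (hN : IsNormalized H) (φ : Mult H) : ∃ f : H, (f : X → ℂ) = φ := by
  obtain ⟨x₀, hx₀⟩ := hN
  refine ⟨mulOp φ (RKHS.kerFun H x₀ (1 : ℂ)), (coe_mulOp φ _).trans ?_⟩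
  funext x
  have h : (RKHS.kerFun H x₀ (1 : ℂ) : H) x = 1 :=
    (RKHS.kerFun_apply H x₀ (1 : ℂ) x).trans (hx₀ x)
  rw [Pi.mul_apply, h, mul_one]

/-- A multiplier of a normalized space, regarded as an element of the space. -/
noncomputable def multToSpace (hN : IsNormalized H) (φ : Mult H) : H :=
  (exists_coe_eq_mult hN φ).choose

theorem coe_multToSpace (hN : IsNormalized H) (φ : Mult H) :
    ⇑(multToSpace hN φ) = φ :=
  (exists_coe_eq_mult hN φ).choose_spec

end

end PickSpace

open scoped InnerProductSpace ComplexConjugate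
open Filter Topology

namespace PickSpace

/-! ### Row contractions of multipliers and positivity -/

section

/-! The implication (2) ⇒ (1) is immediate. For the converse, every `f ∈ H` is a quotient `φ / (1 -
ψ)` of multipliers, with `ψ` contractive and `ψ(x₀) = 0`
(`IsCompletePick.exists_mult_eq_mul_one_sub`). If `h = f g`, then `(1 - ψ) h = φ g`, so (1) gives
`ρ(1 - ψ) ρ(h) = ρ(1 - ψ) ρ(f) ρ(g)`. The factor `ρ(1 - ψ)` cancels: were it zero, `ρ` would vanish
on `(1 - ψ) H`, and `eq_zero_of_inner_mulOp_eq` would force `ρ = 0`.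

For the quotient, the Pick property yields on each finite set a row contraction `β` with `k (1 - ⟨β,
β⟩) = 1` (`IsCompletePick.exists_isRowContraction`). Solving equations with `1 - L_z`, where `L_z =
rowOp β z`, produces the values of the conjugates of `φ` and `ψ` there
(`IsRowContraction.exists_factorization`). An ultrafilter limit over finite sets and the adjoint of
a diagonal operator on kernel functions then give multipliers on all of `X`. -/

theorem posSemidef_gram_sub_gram_iff {ι E F : Type*} [Fintype ι] [NormedAddCommGroup E]
    [InnerProductSpace ℂ E] [NormedAddCommGroup F] [InnerProductSpace ℂ F] (u : ι → E)
    (v : ι → F) : (Matrix.gram ℂ u - Matrix.gram ℂ v).PosSemidef ↔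
      ∀ c : ι → ℂ, ‖∑ i, c i • v i‖ ≤ ‖∑ i, c i • u i‖ := by
  have key : ∀ c : ι → ℂ, star c ⬝ᵥ ((Matrix.gram ℂ u - Matrix.gram ℂ v) *ᵥ c) =
      ((‖∑ i, c i • u i‖ ^ 2 - ‖∑ i, c i • v i‖ ^ 2 : ℝ) : ℂ) := by
    intro c
    rw [Matrix.sub_mulVec, dotProduct_sub, Matrix.star_dotProduct_gram_mulVec,
      Matrix.star_dotProduct_gram_mulVec, inner_self_eq_norm_sq_to_K, inner_self_eq_norm_sq_to_K]
    push_cast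
    rfl
  rw [Matrix.posSemidef_iff_dotProduct_mulVec]
  constructor
  · rintro ⟨-, h⟩ c
    have := h c
    rw [key, Complex.zero_le_real, sub_nonneg] at this
    exact le_of_sq_le_sq this (norm_nonneg _)
  · intro h
    refine ⟨(Matrix.isHermitian_gram ℂ u).sub (Matrix.isHermitian_gram ℂ v), fun c => ?_⟩
    rw [key, Complex.zero_le_real, sub_nonneg]
    gcongr
    exact h c

variable {X H : Type*} [NormedAddCommGroup H] [InnerProductSpace ℂ H] [RKHS ℂ H X ℂ]

/-- A tuple of multipliers is a row contraction if `(f_a)_a ↦ ∑ a, β_a f_a` is a contraction. -/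
def IsRowContraction {r : ℕ} (β : Fin r → Mult H) : Prop :=
  ∀ F : Fin r → H, ‖∑ a, mulOp (β a) (F a)‖ ^ 2 ≤ ∑ a, ‖F a‖ ^ 2

theorem IsContractiveMultiplier.isRowContraction {r : ℕ}
    {Φ : Matrix (Fin r) (Fin r) (Mult H)} (hΦ : IsContractiveMultiplier Φ) (i : Fin r) :
    IsRowContraction (Φ i) := fun F =>
  (Finset.single_le_sum (f := fun i => ‖∑ j, mulOp (Φ i j) (F j)‖ ^ 2)
    (fun _ _ => by positivity) (Finset.mem_univ i)).trans (hΦ F)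

theorem mulOp_apply_apply (φ : Mult H) (f : H) (x : X) :
    mulOp φ f x = (φ : X → ℂ) x * f x := by
  rw [coe_mulOp, Pi.mul_apply]

theorem coe_finsetSum_apply {ι : Type*} (s : Finset ι) (F : ι → H) (x : X) :
    (∑ i ∈ s, F i) x = ∑ i ∈ s, F i x := by
  rw [← RKHS.coeCLM_apply, map_sum, Finset.sum_apply]
  rfl

/-- The operator `∑ a, conj β_a(z) M_{β_a}`. -/
noncomputable def rowOp {r : ℕ} (β : Fin r → Mult H) (z : X) : H →ₗ[ℂ] H :=
  ∑ a, conj ((β a : X → ℂ) z) • mulOp (β a)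

theorem rowOp_eq {r : ℕ} (β : Fin r → Mult H) (z : X) (f : H) :
    rowOp β z f = ∑ a, conj ((β a : X → ℂ) z) • mulOp (β a) f := by
  simp [rowOp]

theorem rowOp_apply {r : ℕ} (β : Fin r → Mult H) (z : X) (f : H) (w : X) :
    rowOp β z f w = (∑ a, (β a : X → ℂ) w * conj ((β a : X → ℂ) z)) * f w := by
  rw [rowOp_eq, coe_finsetSum_apply, Finset.sum_mul]
  refine Finset.sum_congr rfl fun a _ => ?_
  rw [RKHS.coe_smul, Pi.smul_apply, mulOp_apply_apply, smul_eq_mul]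
  ring

variable [CompleteSpace H]

/-- The kernel function `k(·, w)`, as an element of the space. -/
noncomputable def kerVec (H : Type*) [NormedAddCommGroup H] [InnerProductSpace ℂ H]
    [RKHS ℂ H X ℂ] [CompleteSpace H] (w : X) : H := RKHS.kerFun H w (1 : ℂ)

theorem inner_kerVec_left (x : X) (f : H) : ⟪kerVec H x, f⟫_ℂ = f x := by
  simp [kerVec]

theorem inner_kerVec_right (x : X) (f : H) : ⟪f, kerVec H x⟫_ℂ = conj (f x) := by
  simp [kerVec]

theorem kerVec_apply (z w : X) : kerVec H w z = ker H z w :=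
  RKHS.kerFun_apply H w (1 : ℂ) z

theorem ker_eq_inner (z w : X) : ker H z w = ⟪kerVec H z, kerVec H w⟫_ℂ := by
  rw [inner_kerVec_left, kerVec_apply]

theorem conj_ker (z w : X) : conj (ker H z w) = ker H w z := by
  rw [ker_eq_inner, ker_eq_inner, inner_conj_symm]

theorem ker_self (z : X) : ker H z z = ((‖kerVec H z‖ ^ 2 : ℝ) : ℂ) := by
  rw [ker_eq_inner, inner_self_eq_norm_sq_to_K]
  push_cast
  rfl

/-- The adjoint of the row sends `k(·,z)` to the column `(conj β_a(z) k(·,z))_a` and is a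
contraction. The proof avoids the adjoint through `‖V‖² = ⟪g, ∑ β_a V_a⟫ ≤ ‖g‖ ‖V‖`. -/
theorem IsRowContraction.posSemidef {r : ℕ} {β : Fin r → Mult H} (hβ : IsRowContraction β)
    {ι : Type*} [Fintype ι] (z : ι → X) :
    (Matrix.of fun i j => ker H (z i) (z j) *
      (1 - ∑ a, (β a : X → ℂ) (z i) * conj ((β a : X → ℂ) (z j)))).PosSemidef := by
  let v : ι → PiLp 2 (fun _ : Fin r => H) := fun i =>
    WithLp.toLp 2 fun a => conj ((β a : X → ℂ) (z i)) • kerVec H (z i)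
  have h : (Matrix.gram ℂ (fun i => kerVec H (z i)) - Matrix.gram ℂ v).PosSemidef := by
    rw [posSemidef_gram_sub_gram_iff]
    intro c
    set V := ∑ i, c i • v i with hV
    set g := ∑ i, c i • kerVec H (z i) with hg
    have h1 : ⟪V, V⟫_ℂ = ⟪g, ∑ a, mulOp (β a) (V a)⟫_ℂ := by
      conv_lhs => rw [PiLp.inner_apply]
      rw [inner_sum]
      refine Finset.sum_congr rfl fun a _ => ?_
      rw [hg, sum_inner]
      have : V a = ∑ i, (c i * conj ((β a : X → ℂ) (z i))) • kerVec H (z i) := by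
        simp [hV, v, smul_smul]
      conv_lhs => enter [2]; rw [this]
      rw [sum_inner]
      refine Finset.sum_congr rfl fun i _ => ?_
      rw [inner_smul_left, inner_smul_left, inner_kerVec_left, inner_kerVec_left,
        mulOp_apply_apply]
      simp [mul_assoc]
    have h2 : ‖V‖ ^ 2 ≤ ‖g‖ * ‖V‖ := by
      have h3 : ‖∑ a, mulOp (β a) (V a)‖ ≤ ‖V‖ := by
        refine le_of_sq_le_sq ((hβ fun a => V a).trans ?_) (norm_nonneg _)
        rw [PiLp.norm_sq_eq_of_L2]
      calc ‖V‖ ^ 2 = ‖⟪V, V⟫_ℂ‖ := by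
            rw [inner_self_eq_norm_sq_to_K]; simp
        _ ≤ ‖g‖ * ‖∑ a, mulOp (β a) (V a)‖ := by rw [h1]; exact norm_inner_le_norm _ _
        _ ≤ ‖g‖ * ‖V‖ := by gcongr
    rcases (norm_nonneg V).eq_or_lt with h0 | h0
    · rw [← h0]; positivity
    · rw [sq] at h2; exact le_of_mul_le_mul_right h2 h0
  convert h using 1
  ext i j
  simp only [Matrix.of_apply, Matrix.sub_apply, Matrix.gram_apply, PiLp.inner_apply, v,
    inner_smul_left, inner_smul_right, ← ker_eq_inner, mul_sub, mul_one, Finset.mul_sum,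
    Complex.conj_conj]
  congr 1
  refine Finset.sum_congr rfl fun a _ => ?_
  ring

/-- Since `k = 1 + k ⟨β, β⟩` on the points, the matrix is the Gram matrix of `q` plus the Schur
product of `k` with `⟨β, β⟩⟪q, q⟫ - ⟪L q, L q⟫`. The latter is positive because the row contracts
the columns `(conj β_a(z_i) q_i)_a`. -/
theorem IsRowContraction.posSemidef_ker_mul {r : ℕ} {β : Fin r → Mult H}
    (hβ : IsRowContraction β) {ι : Type*} [Fintype ι] (z : ι → X)
    (hk : ∀ i j, ker H (z i) (z j) *
      (1 - ∑ a, (β a : X → ℂ) (z i) * conj ((β a : X → ℂ) (z j))) = 1) (q : ι → H) :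
    (Matrix.of fun i j => ker H (z i) (z j) *
      (⟪q i, q j⟫_ℂ - ⟪rowOp β (z i) (q i), rowOp β (z j) (q j)⟫_ℂ)).PosSemidef := by
  let v : ι → PiLp 2 (fun _ : Fin r => H) := fun i =>
    WithLp.toLp 2 fun a => conj ((β a : X → ℂ) (z i)) • q i
  have h : (Matrix.gram ℂ v - Matrix.gram ℂ fun i => rowOp β (z i) (q i)).PosSemidef := by
    rw [posSemidef_gram_sub_gram_iff]
    intro c
    set V := ∑ i, c i • v i with hV
    have h1 : ∑ i, c i • rowOp β (z i) (q i) = ∑ a, mulOp (β a) (V a) := by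
      have : ∀ a, V a = ∑ i, c i • conj ((β a : X → ℂ) (z i)) • q i := by
        simp [hV, v]
      simp only [this, map_sum, map_smul, rowOp_eq, Finset.smul_sum]
      exact Finset.sum_comm
    rw [h1]
    refine le_of_sq_le_sq ((hβ fun a => V a).trans ?_) (norm_nonneg _)
    rw [PiLp.norm_sq_eq_of_L2]
  have h' := (Matrix.posSemidef_gram ℂ q).add
    ((Matrix.posSemidef_gram ℂ fun i => kerVec H (z i)).hadamard h)
  refine (congrArg Matrix.PosSemidef (Matrix.ext fun i j => ?_)).mpr h'
  have hv : ⟪v i, v j⟫_ℂ =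
      (∑ a, (β a : X → ℂ) (z i) * conj ((β a : X → ℂ) (z j))) * ⟪q i, q j⟫_ℂ := by
    simp only [PiLp.inner_apply, v, inner_smul_left, inner_smul_right, Complex.conj_conj,
      Finset.sum_mul]
    refine Finset.sum_congr rfl fun a _ => ?_
    ring
  simp only [Matrix.of_apply, Matrix.add_apply, Matrix.hadamard_apply, Matrix.sub_apply,
    Matrix.gram_apply, ← ker_eq_inner, hv]
  linear_combination (⟪q i, q j⟫_ℂ) * hk i j

end

/-! ### Realizing `1 - 1/k` by a row contraction on finite sets -/

section

variable {X H : Type*} [NormedAddCommGroup H] [InnerProductSpace ℂ H] [RKHS ℂ H X ℂ]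
  [CompleteSpace H]

/-- Place `b` in the top row of square matrices that are zero elsewhere. In the Pick matrix the
corner block is then constantly `1`, the other diagonal blocks are `k`, and the rest vanishes: a
Gram matrix. -/
theorem IsCompletePick.exists_isRowContraction_eq (hP : IsCompletePick H) {x₀ : X}
    (hx₀ : ∀ x, ker H x x₀ = 1) {r : ℕ} (T : Finset X) (b : X → Fin (r + 1) → ℂ)
    (hb : ∀ z ∈ T, ∀ w ∈ T, ker H z w * (1 - ∑ a, b z a * conj (b w a)) = 1) :
    ∃ β : Fin (r + 1) → Mult H, IsRowContraction β ∧
      ∀ z ∈ T, ∀ a, (β a : X → ℂ) z = b z a := by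
  let e := T.equivFin.symm
  let z : Fin T.card → X := fun i => e i
  let W : Fin T.card → Matrix (Fin (r + 1)) (Fin (r + 1)) ℂ := fun i =>
    Matrix.of fun a c => if a = 0 then b (z i) c else 0
  let v : Fin T.card × Fin (r + 1) → PiLp 2 (fun _ : Fin (r + 1) => H) := fun p =>
    WithLp.toLp 2 (Pi.single p.2 (if p.2 = 0 then kerVec H x₀ else kerVec H (z p.1)))
  obtain ⟨Φ, hΦ, hW⟩ := hP (r + 1) T.card z W (by
    refine (congrArg Matrix.PosSemidef (Matrix.ext fun p q => ?_)).mpr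
      (Matrix.posSemidef_gram ℂ v)
    obtain ⟨i, a⟩ := p
    obtain ⟨j, c⟩ := q
    have hv : ⟪v (i, a), v (j, c)⟫_ℂ = if a = c then
        (if a = 0 then 1 else ker H (z i) (z j)) else 0 := by
      rw [PiLp.inner_apply]
      simp only [v]
      rw [Finset.sum_eq_single a]
      · by_cases hac : a = c
        · subst hac
          by_cases ha : a = 0
          · simp only [ha, if_true, Pi.single_eq_same]
            rw [← ker_eq_inner, hx₀]
          · simp [ha, ← ker_eq_inner]
        · simp [hac]
      · intro d _ hd
        simp [hd]
      · simp
    have hWW : (W i * (W j)ᴴ) a c =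
        if a = 0 then (if c = 0 then ∑ d, b (z i) d * conj (b (z j) d) else 0) else 0 := by
      rw [Matrix.mul_apply]
      by_cases ha : a = 0 <;> by_cases hc : c = 0 <;> simp [W, ha, hc]
    have hij := hb (z i) (e i).2 (z j) (e j).2
    rw [Matrix.gram_apply, hv, Matrix.of_apply, Matrix.sub_apply, hWW, Matrix.one_apply]
    by_cases hac : a = c
    · subst hac
      by_cases ha : a = 0
      · simpa [ha] using hij
      · simp [ha]
    · by_cases ha : a = 0
      · subst ha
        simp [hac, Ne.symm hac]
      · simp [hac, ha])
  refine ⟨Φ 0, hΦ.isRowContraction 0, fun w hw a => ?_⟩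
  have := hW (e.symm ⟨w, hw⟩) 0 a
  simpa [z, W] using this

/-- Points are added one at a time. Positivity for the old `β` shows that only the diagonal entry at
the new point can differ from `1`, and only upwards; one extra coordinate supported there corrects
it, and interpolation turns the corrected values into multipliers. -/
theorem IsCompletePick.exists_isRowContraction (hP : IsCompletePick H) {x₀ : X}
    (hx₀ : ∀ x, ker H x x₀ = 1) (S : Finset X) (hS : x₀ ∈ S) :
    ∃ (r : ℕ) (β : Fin r → Mult H), IsRowContraction β ∧ ∀ z ∈ S, ∀ w ∈ S,
      ker H z w * (1 - ∑ a, (β a : X → ℂ) z * conj ((β a : X → ℂ) w)) = 1 := by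
  classical
  suffices h : ∀ S : Finset X, ∃ (r : ℕ) (β : Fin r → Mult H), IsRowContraction β ∧
      ∀ z ∈ insert x₀ S, ∀ w ∈ insert x₀ S,
      ker H z w * (1 - ∑ a, (β a : X → ℂ) z * conj ((β a : X → ℂ) w)) = 1 by
    simpa [hS] using h S
  intro S
  induction S using Finset.induction_on with
  | empty => exact ⟨0, Fin.elim0, fun F => by simp, by simp [hx₀]⟩
  | insert y S hy ih =>
    obtain ⟨r, β, hβ, hk⟩ := ih
    set M : X → X → ℂ := fun z w =>
      ker H z w * (1 - ∑ a, (β a : X → ℂ) z * conj ((β a : X → ℂ) w)) with hM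
    have hM0 : M x₀ x₀ = 1 := hk _ (by simp) _ (by simp)
    have hβ0 : ∀ a, (β a : X → ℂ) x₀ = 0 := by
      have h1 : ∑ a, (β a : X → ℂ) x₀ * conj ((β a : X → ℂ) x₀) = 0 := by
        have := hM0
        rw [hM] at this
        simpa [hx₀] using this
      simp_rw [Complex.mul_conj] at h1
      rw [← Complex.ofReal_sum, Complex.ofReal_eq_zero,
        Finset.sum_eq_zero_iff_of_nonneg fun _ _ => Complex.normSq_nonneg _] at h1
      exact fun a => Complex.normSq_eq_zero.1 (h1 a (Finset.mem_univ a))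
    have hM1 : ∀ w, M w x₀ = 1 := fun w => by simp [hM, hβ0, hx₀]
    have hconj : ∀ z w, conj (M z w) = M w z := fun z w => by
      simp [hM, conj_ker, mul_comm]
    have hM1' : ∀ w, M x₀ w = 1 := fun w => by rw [← hconj, hM1, map_one]
    have hyM : ∀ z ∈ insert x₀ S, M y z = 1 := by
      intro z hz
      -- The quadratic form vanishes at `(1, -1, 0)`, so this vector lies in the kernel of the
      -- matrix; the row of `y` then gives `M y z = M y x₀ = 1`.
      have hpsd := hβ.posSemidef ![z, x₀, y]
      have hzero := (hpsd.dotProduct_mulVec_zero_iff ![1, -1, 0]).1 (by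
        have h1 := hk z hz z hz
        have h2 := hM1 z
        have h3 := hM1' z
        simp only [hM] at h2 h3 hM0
        simp [Matrix.mulVec, dotProduct, Fin.sum_univ_three, h1, h2, h3, hM0])
      have := congrFun hzero 2
      have h4 := hM1 y
      simp only [hM] at h4 ⊢
      simp [Matrix.mulVec, dotProduct, Fin.sum_univ_three, h4] at this
      linear_combination this
    have hyM' : ∀ z ∈ insert x₀ S, M z y = 1 := fun z hz => by
      rw [← hconj, hyM z hz, map_one]
    obtain ⟨m, hm⟩ : ∃ m : ℝ, M y y = m :=
      ⟨_, (Complex.conj_eq_iff_re.1 (hconj y y)).symm⟩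
    have hm1 : 1 ≤ m := by
      have hpsd := (hβ.posSemidef ![x₀, y]).dotProduct_mulVec_nonneg ![1, -1]
      have h1 := hM1 y
      have h2 := hM1' y
      have h3 := hm
      simp only [hM] at h1 h2 h3 hM0
      simp [Matrix.mulVec, dotProduct, Fin.sum_univ_two, h1, h2, h3, hM0] at hpsd
      exact_mod_cast hpsd
    set κ : ℝ := ‖kerVec H y‖ ^ 2 with hκ
    have hκy : ker H y y = κ := ker_self y
    have hκ0 : κ ≠ 0 := by
      intro h0
      have h2 := hm
      simp only [hM, hκy, h0] at h2
      rw [Complex.ofReal_zero, zero_mul, eq_comm, Complex.ofReal_eq_zero] at h2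
      linarith
    have hκ1 : 0 < κ := lt_of_le_of_ne (by positivity) hκ0.symm
    -- Chosen so that the new coordinate lowers the entry at `(y, y)` by `κ s² = m - 1`.
    set s : ℝ := Real.sqrt ((m - 1) / κ)
    have hs : κ * (s * s) = m - 1 := by
      rw [Real.mul_self_sqrt (div_nonneg (by linarith) hκ1.le)]
      field_simp
    set b : X → Fin (r + 1) → ℂ := fun x =>
      Fin.cons (if x = y then (s : ℂ) else 0) fun a => (β a : X → ℂ) x with hb
    have hmem : ∀ z ∈ insert x₀ (insert y S), z ≠ y → z ∈ insert x₀ S := by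
      intro z hz hzy
      simpa [hzy] using hz
    have hbk : ∀ z ∈ insert x₀ (insert y S), ∀ w ∈ insert x₀ (insert y S),
        ker H z w * (1 - ∑ a, b z a * conj (b w a)) = 1 := by
      intro z hz w hw
      simp only [hb, Fin.sum_univ_succ, Fin.cons_zero, Fin.cons_succ]
      by_cases hzy : z = y
      · by_cases hwy : w = y
        · subst hzy hwy
          simp only [if_true, Complex.conj_ofReal]
          have hs' : (κ : ℂ) * (s * s) = m - 1 := by exact_mod_cast hs
          simp only [hM] at hm
          rw [hκy] at hm ⊢
          linear_combination hm - hs'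
        · subst hzy
          simpa [hwy, hM] using hyM w (hmem w hw hwy)
      · by_cases hwy : w = y
        · subst hwy
          simpa [hzy, hM] using hyM' z (hmem z hz hzy)
        · simpa [hzy] using hk z (hmem z hz hzy) w (hmem w hw hwy)
    obtain ⟨γ, hγ, hγb⟩ := hP.exists_isRowContraction_eq hx₀ _ b hbk
    refine ⟨r + 1, γ, hγ, fun z hz w hw => ?_⟩
    simpa only [hγb z hz, hγb w hw] using hbk z hz w hw

end

/-! ### Factorization on a finite set -/

section

variable {X H : Type*} [NormedAddCommGroup H] [InnerProductSpace ℂ H] [RKHS ℂ H X ℂ]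

theorem IsRowContraction.norm_rowOp_sq_le {r : ℕ} {β : Fin r → Mult H}
    (hβ : IsRowContraction β) (z : X) (f : H) :
    ‖rowOp β z f‖ ^ 2 ≤ (∑ a, ‖(β a : X → ℂ) z‖ ^ 2) * ‖f‖ ^ 2 := by
  have h := hβ fun a => conj ((β a : X → ℂ) z) • f
  simp only [map_smul, ← rowOp_eq, norm_smul, mul_pow, ← Finset.sum_mul, RCLike.norm_conj] at h
  exact h

variable [CompleteSpace H]

theorem sum_norm_sq_lt_one {r : ℕ} {β : Fin r → Mult H} {z : X}
    (hk : ker H z z * (1 - ∑ a, (β a : X → ℂ) z * conj ((β a : X → ℂ) z)) = 1) :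
    ∑ a, ‖(β a : X → ℂ) z‖ ^ 2 < 1 := by
  rw [ker_self] at hk
  simp_rw [Complex.mul_conj, Complex.normSq_eq_norm_sq] at hk
  have hk' : ‖kerVec H z‖ ^ 2 * (1 - ∑ a, ‖(β a : X → ℂ) z‖ ^ 2) = 1 := by exact_mod_cast hk
  by_contra! h
  nlinarith [sq_nonneg ‖kerVec H z‖]

theorem IsRowContraction.exists_sub_rowOp_eq {r : ℕ} {β : Fin r → Mult H}
    (hβ : IsRowContraction β) {z : X} (hz : ∑ a, ‖(β a : X → ℂ) z‖ ^ 2 < 1) (h : H) :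
    ∃ e : H, e - rowOp β z e = h := by
  set t := ∑ a, ‖(β a : X → ℂ) z‖ ^ 2
  have ht : 0 ≤ t := Finset.sum_nonneg fun _ _ => by positivity
  let L : H →L[ℂ] H := (rowOp β z).mkContinuous (√t) fun f => by
    refine le_of_sq_le_sq ((hβ.norm_rowOp_sq_le z f).trans_eq ?_) (by positivity)
    rw [mul_pow, Real.sq_sqrt ht]
  have hL : ‖L‖ < 1 := ((rowOp β z).mkContinuous_norm_le (Real.sqrt_nonneg t) _).trans_lt
    ((Real.sqrt_lt' one_pos).2 (by simpa using hz))
  refine ⟨((Units.oneSub L hL)⁻¹ : (H →L[ℂ] H)ˣ).val h, ?_⟩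
  have := congrArg (fun T : H →L[ℂ] H => T h) (Units.oneSub L hL).mul_inv
  simpa [L] using this

theorem norm_sum_mul_kerVec_le {ι : Type*} [Fintype ι] (z : ι → X) (η : ι → ℂ)
    (h : (Matrix.of fun i j => ker H (z i) (z j) * (1 - conj (η i) * η j)).PosSemidef)
    (c : ι → ℂ) : ‖∑ i, (c i * η i) • kerVec H (z i)‖ ≤ ‖∑ i, c i • kerVec H (z i)‖ := by
  have := (posSemidef_gram_sub_gram_iff (fun i => kerVec H (z i))
    (fun i => η i • kerVec H (z i))).1 (by
      refine (congrArg Matrix.PosSemidef (Matrix.ext fun i j => ?_)).mp h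
      simp only [Matrix.of_apply, Matrix.sub_apply, Matrix.gram_apply, inner_smul_left,
        inner_smul_right, ← ker_eq_inner]
      ring) c
  simpa only [smul_smul] using this

/-- Values of a factorization of `u`, up to complex conjugation, by contractive multipliers on
a finite set, for a unit vector `u` determined by its values on the set. -/
theorem IsRowContraction.exists_factorization {r : ℕ} {β : Fin r → Mult H}
    (hβ : IsRowContraction β) {ι : Type*} [Fintype ι] (z : ι → X)
    (hk : ∀ i j, ker H (z i) (z j) *
      (1 - ∑ a, (β a : X → ℂ) (z i) * conj ((β a : X → ℂ) (z j))) = 1)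
    (i₀ : ι) (hi₀ : ∀ x, ker H x (z i₀) = 1) (u : H) (hu : ‖u‖ = 1)
    (huz : ∀ g g' : H, (∀ i, g (z i) = g' (z i)) → ⟪u, g⟫_ℂ = ⟪u, g'⟫_ℂ) :
    ∃ η θ : ι → ℂ, (∀ i, η i = conj (u (z i)) * (1 - θ i)) ∧ θ i₀ = 0 ∧
      (∀ c : ι → ℂ, ‖∑ i, (c i * η i) • kerVec H (z i)‖ ≤ ‖∑ i, c i • kerVec H (z i)‖) ∧
      (∀ c : ι → ℂ, ‖∑ i, (c i * θ i) • kerVec H (z i)‖ ≤ ‖∑ i, c i • kerVec H (z i)‖) := by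
  have hlt : ∀ i, ∑ a, ‖(β a : X → ℂ) (z i)‖ ^ 2 < 1 := fun i => sum_norm_sq_lt_one (hk i i)
  set K₀ := kerVec H (z i₀)
  have hK₀ : ∀ x, K₀ x = 1 := fun x => (kerVec_apply x (z i₀)).trans (hi₀ x)
  have hβ0 : ∀ a, (β a : X → ℂ) (z i₀) = 0 := by
    have h1 := hk i₀ i₀
    rw [hi₀, one_mul, sub_eq_self] at h1
    simp_rw [Complex.mul_conj] at h1
    rw [← Complex.ofReal_sum, Complex.ofReal_eq_zero,
      Finset.sum_eq_zero_iff_of_nonneg fun _ _ => Complex.normSq_nonneg _] at h1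
    exact fun a => Complex.normSq_eq_zero.1 (h1 a (Finset.mem_univ a))
  have hL₀ : ∀ i q, ⟪K₀, rowOp β (z i) q⟫_ℂ = 0 := fun i q => by
    rw [inner_kerVec_left, rowOp_apply]
    simp [hβ0]
  have hL₀' : ∀ i q, ⟪rowOp β (z i) q, K₀⟫_ℂ = 0 := fun i q => by
    rw [← inner_conj_symm, hL₀, map_zero]
  have hK₀K₀ : ⟪K₀, K₀⟫_ℂ = 1 := by rw [inner_kerVec_left, hK₀]
  have huu : ⟪u, u⟫_ℂ = 1 := by rw [inner_self_eq_norm_sq_to_K, hu]; simp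
  choose e he using fun i => hβ.exists_sub_rowOp_eq (hlt i) K₀
  choose g hg using fun i => hβ.exists_sub_rowOp_eq (hlt i) u
  -- By `hk`, `e i` agrees with `k(·, z i)` at all the points, and pairing with `u` sees only these
  -- values.
  have heu : ∀ i, ⟪u, e i⟫_ℂ = conj (u (z i)) := by
    intro i
    rw [← inner_kerVec_right]
    refine huz _ _ fun j => ?_
    have h1 := congrArg (fun f : H => f (z j)) (he i)
    simp only [RKHS.coe_sub, Pi.sub_apply, rowOp_apply, hK₀] at h1
    rw [kerVec_apply]
    linear_combination (ker H (z j) (z i)) * h1 - (e i (z j)) * hk j i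
  -- Otherwise `‖L g‖² = ‖g - u‖² = ‖g‖² + 1`, although `L` is a contraction.
  have hv : ∀ i, ⟪u, g i⟫_ℂ ≠ 0 := by
    intro i h0
    have h1 : ‖rowOp β (z i) (g i)‖ ^ 2 ≤ ‖g i‖ ^ 2 :=
      (hβ.norm_rowOp_sq_le _ _).trans (mul_le_of_le_one_left (by positivity) (hlt i).le)
    have h2 : rowOp β (z i) (g i) = g i - u := by rw [← hg i]; abel
    have h3 : ⟪g i, u⟫_ℂ = 0 := by rw [← inner_conj_symm, h0, map_zero]
    rw [h2, norm_sub_sq (𝕜 := ℂ), h3, hu] at h1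
    simp at h1
    linarith
  refine ⟨fun i => ⟪u, e i⟫_ℂ / ⟪u, g i⟫_ℂ, fun i => 1 - (⟪u, g i⟫_ℂ)⁻¹, fun i => ?_, ?_,
    norm_sum_mul_kerVec_le z _ ?_, norm_sum_mul_kerVec_le z _ ?_⟩
  · simp only [heu]
    ring
  · have : g i₀ = u := by
      conv_rhs => rw [← hg i₀]
      rw [rowOp_eq]
      simp [hβ0]
    simp [this, hu]
  · set η : ι → ℂ := fun i => ⟪u, e i⟫_ℂ / ⟪u, g i⟫_ℂ with hη
    -- The choice of `η` makes `q` orthogonal to `u`. Both sides of `q + η u = K₀ + L q` are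
    -- orthogonal sums, so comparing inner products gives `1 - conj η_i η_j = ⟪q_i, q_j⟫ - ⟪L q_i, L
    -- q_j⟫`.
    set q : ι → H := fun i => e i - η i • g i with hq
    have huq : ∀ i, ⟪u, q i⟫_ℂ = 0 := fun i => by
      rw [hq, inner_sub_right, inner_smul_right, hη, div_mul_cancel₀ _ (hv i), sub_self]
    have hqu : ∀ i, ⟪q i, u⟫_ℂ = 0 := fun i => by rw [← inner_conj_symm, huq, map_zero]
    have hqL : ∀ i, q i + η i • u = K₀ + rowOp β (z i) (q i) := by
      intro i
      simp only [hq, map_sub, map_smul]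
      linear_combination (norm := module) he i - η i • hg i
    refine (congrArg Matrix.PosSemidef (Matrix.ext fun i j => ?_)).mp
      (hβ.posSemidef_ker_mul z hk q)
    have h1 : ⟪q i + η i • u, q j + η j • u⟫_ℂ =
        ⟪K₀ + rowOp β (z i) (q i), K₀ + rowOp β (z j) (q j)⟫_ℂ := by rw [hqL, hqL]
    simp only [inner_add_left, inner_add_right, inner_smul_left, inner_smul_right, huq, hqu,
      huu, hL₀, hL₀', hK₀K₀] at h1
    simp only [Matrix.of_apply]
    linear_combination (ker H (z i) (z j)) * h1
  · set v : ι → ℂ := fun i => (⟪u, g i⟫_ℂ)⁻¹ with hv'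
    -- Now `⟪u, q⟫ = 1` and `L q = q - v u`, whence `⟪q_i, q_j⟫ - ⟪L q_i, L q_j⟫ = 1 - conj (1 -
    -- v_i) (1 - v_j)`.
    set q : ι → H := fun i => v i • g i with hq
    have huq : ∀ i, ⟪u, q i⟫_ℂ = 1 := fun i => by
      rw [hq, inner_smul_right, hv', inv_mul_cancel₀ (hv i)]
    have hqu : ∀ i, ⟪q i, u⟫_ℂ = 1 := fun i => by rw [← inner_conj_symm, huq, map_one]
    have hqL : ∀ i, rowOp β (z i) (q i) = q i - v i • u := by
      intro i
      simp only [hq, map_smul]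
      linear_combination (norm := module) -(v i) • hg i
    refine (congrArg Matrix.PosSemidef (Matrix.ext fun i j => ?_)).mp
      (hβ.posSemidef_ker_mul z hk q)
    simp only [Matrix.of_apply, hqL, inner_sub_left, inner_sub_right, inner_smul_left,
      inner_smul_right, huq, hqu, huu, map_sub, map_one]
    simp only [hv']
    ring

end

/-! ### From finite sets to multipliers on `X` -/

section

variable {X H : Type*} [NormedAddCommGroup H] [InnerProductSpace ℂ H] [RKHS ℂ H X ℂ]
  [CompleteSpace H]

theorem kerVec_ne_zero {x₀ : X} (hx₀ : ∀ x, ker H x x₀ = 1) (x : X) : kerVec H x ≠ 0 := by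
  intro h
  have := kerVec_apply (H := H) x₀ x
  rw [← conj_ker, hx₀, h, RKHS.coe_zero] at this
  simp at this

/-- Projecting `f` onto the span of the kernel functions at `S` keeps its values on `S` and makes
pairing with it depend only on values on `S`. -/
theorem IsCompletePick.exists_factorization_subtype (hP : IsCompletePick H) {x₀ : X}
    (hx₀ : ∀ x, ker H x x₀ = 1) (S : Finset X) (hS : x₀ ∈ S) (f : H) (hf : ‖f‖ ≤ 1) :
    ∃ η θ : S → ℂ, (∀ i, η i = conj (f i) * (1 - θ i)) ∧ θ ⟨x₀, hS⟩ = 0 ∧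
      (∀ c : S → ℂ, ‖∑ i, (c i * η i) • kerVec H (i : X)‖ ≤ ‖∑ i, c i • kerVec H (i : X)‖) ∧
      (∀ c : S → ℂ, ‖∑ i, (c i * θ i) • kerVec H (i : X)‖ ≤
        ‖∑ i, c i • kerVec H (i : X)‖) := by
  obtain ⟨r, β, hβ, hk⟩ := hP.exists_isRowContraction hx₀ S hS
  let V : Submodule ℂ H := Submodule.span ℂ (Set.range fun i : S => kerVec H (i : X))
  have : FiniteDimensional ℂ V := FiniteDimensional.span_of_finite ℂ (Set.finite_range _)
  set u := V.starProjection f with hu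
  have huV : u ∈ V := V.starProjection_apply_mem f
  have hunorm : ‖u‖ ≤ 1 := (V.norm_starProjection_apply_le f).trans hf
  have huf : ∀ i : S, u i = f i := by
    intro i
    have := V.starProjection_inner_eq_zero f (kerVec H (i : X))
      (Submodule.subset_span ⟨i, rfl⟩)
    rw [inner_kerVec_right, map_eq_zero, RKHS.coe_sub, Pi.sub_apply, sub_eq_zero] at this
    exact this.symm
  have huz : ∀ w ∈ V, ∀ g g' : H, (∀ i : S, g i = g' i) → ⟪w, g⟫_ℂ = ⟪w, g'⟫_ℂ := by
    intro w hw g g' hgg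
    induction hw using Submodule.span_induction with
    | mem x hx =>
      obtain ⟨i, rfl⟩ := hx
      simpa [inner_kerVec_left] using hgg i
    | zero => simp
    | add x y _ _ hx hy => rw [inner_add_left, inner_add_left, hx, hy]
    | smul a x _ hx => rw [inner_smul_left, inner_smul_left, hx]
  by_cases hu0 : u = 0
  · refine ⟨0, 0, fun i => ?_, rfl, fun c => by simp, fun c => by simp⟩
    rw [← huf, hu0, RKHS.coe_zero]
    simp
  have hn : ‖u‖ ≠ 0 := norm_ne_zero_iff.2 hu0
  obtain ⟨η, θ, h1, h2, h3, h4⟩ := hβ.exists_factorization (fun i : S => (i : X))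
    (fun i j => hk i i.2 j j.2) ⟨x₀, hS⟩ hx₀ ((‖u‖⁻¹ : ℂ) • u) (by simp [norm_smul, hn])
    (huz _ (V.smul_mem _ huV))
  refine ⟨fun i => ‖u‖ * η i, θ, fun i => ?_, h2, fun c => ?_, h4⟩
  · have : (‖u‖ : ℂ) ≠ 0 := by exact_mod_cast hn
    simp only [h1, RKHS.coe_smul, Pi.smul_apply, huf, smul_eq_mul, map_mul, map_inv₀,
      Complex.conj_ofReal]
    field_simp
  · have : ∑ i, (c i * (‖u‖ * η i)) • kerVec H (i : X) =
        (‖u‖ : ℂ) • ∑ i, (c i * η i) • kerVec H (i : X) := by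
      rw [Finset.smul_sum]
      refine Finset.sum_congr rfl fun i _ => ?_
      rw [smul_smul]
      ring_nf
    rw [this, norm_smul, Complex.norm_real, norm_norm]
    exact (mul_le_of_le_one_left (norm_nonneg _) hunorm).trans (h3 c)

/-- The diagonal operator `k(·, x) ↦ η(x) k(·, x)` is contractive on combinations of kernel
functions at points of `S`. -/
def IsContractiveOn (H : Type*) [NormedAddCommGroup H] [InnerProductSpace ℂ H]
    [RKHS ℂ H X ℂ] [CompleteSpace H] (η : X → ℂ) (S : Finset X) : Prop :=
  ∀ c : X → ℂ, ‖∑ x ∈ S, (c x * η x) • kerVec H x‖ ≤ ‖∑ x ∈ S, c x • kerVec H x‖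

theorem IsContractiveOn.mono {η : X → ℂ} {S T : Finset X} (h : IsContractiveOn H η S)
    (hT : T ⊆ S) : IsContractiveOn H η T := by
  classical
  intro c
  have := h fun x => if x ∈ T then c x else 0
  simpa only [ite_mul, zero_mul, ite_smul, zero_smul, Finset.sum_ite_mem,
    Finset.inter_eq_right.2 hT] using this

theorem IsContractiveOn.norm_le_one {x₀ : X} (hx₀ : ∀ x, ker H x x₀ = 1) {η : X → ℂ}
    {S : Finset X} (h : IsContractiveOn H η S) {x : X} (hx : x ∈ S) : ‖η x‖ ≤ 1 := by
  have := h.mono (Finset.singleton_subset_iff.2 hx) 1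
  simp only [Finset.sum_singleton, Pi.one_apply, one_mul, one_smul, norm_smul] at this
  exact le_of_mul_le_mul_right (by simpa using this) (norm_pos_iff.2 (kerVec_ne_zero hx₀ x))

theorem isContractiveOn_extend [DecidableEq X] {S : Finset X} (η : S → ℂ)
    (h : ∀ c : S → ℂ, ‖∑ i, (c i * η i) • kerVec H (i : X)‖ ≤
      ‖∑ i, c i • kerVec H (i : X)‖) :
    IsContractiveOn H (fun x => if hx : x ∈ S then η ⟨x, hx⟩ else 0) S := by
  intro c
  have := h fun i => c i
  rw [← Finset.sum_coe_sort S, ← Finset.sum_coe_sort S]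
  simpa using this

theorem isContractiveOn_of_tendsto {α : Type*} {l : Filter α} [l.NeBot] {F : α → X → ℂ}
    {η : X → ℂ} (hF : ∀ x, Tendsto (fun a => F a x) l (𝓝 (η x))) {S : Finset X}
    (h : ∀ᶠ a in l, IsContractiveOn H (F a) S) : IsContractiveOn H η S := by
  intro c
  refine le_of_tendsto (f := fun a => ‖∑ x ∈ S, (c x * F a x) • kerVec H x‖) (x := l) ?_
    (h.mono fun a ha => ha c)
  exact (tendsto_finsetSum _ fun x _ => ((hF x).const_mul (c x)).smul_const _).norm

theorem exists_tendsto_ultrafilter {α : Type*} (l : Ultrafilter α) (F : α → X → ℂ)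
    (hF : ∀ a x, ‖F a x‖ ≤ 1) : ∃ η : X → ℂ, ∀ x, Tendsto (fun a => F a x) l (𝓝 (η x)) := by
  have h : ∀ x, ∃ y, Tendsto (fun a => F a x) l (𝓝 y) := by
    intro x
    obtain ⟨y, -, hy⟩ := (isCompact_closedBall (0 : ℂ) 1).ultrafilter_le_nhds'
      (l.map fun a => F a x) (by
        rw [Ultrafilter.mem_map]
        exact univ_mem' fun a => by simpa using hF a x)
    exact ⟨y, hy⟩
  choose η hη using h
  exact ⟨η, hη⟩

/-- The finite solutions, extended by zero, are bounded by `1`, so they converge pointwise along an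
ultrafilter finer than `atTop` on finite sets; all the conditions are closed. -/
theorem IsCompletePick.exists_factorization (hP : IsCompletePick H) {x₀ : X}
    (hx₀ : ∀ x, ker H x x₀ = 1) (f : H) (hf : ‖f‖ ≤ 1) :
    ∃ η θ : X → ℂ, (∀ x, η x = conj (f x) * (1 - θ x)) ∧ θ x₀ = 0 ∧
      (∀ S, IsContractiveOn H η S) ∧ (∀ S, IsContractiveOn H θ S) := by
  classical
  have hfin : ∀ S : Finset X, ∃ η θ : X → ℂ, (∀ x ∈ S, η x = conj (f x) * (1 - θ x)) ∧
      θ x₀ = 0 ∧ IsContractiveOn H η S ∧ IsContractiveOn H θ S ∧ (∀ x, ‖η x‖ ≤ 1) ∧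
      (∀ x, ‖θ x‖ ≤ 1) := by
    intro S
    obtain ⟨η, θ, h1, h2, h3, h4⟩ := hP.exists_factorization_subtype hx₀ (insert x₀ S)
      (Finset.mem_insert_self _ _) f hf
    have h3' := isContractiveOn_extend η h3
    have h4' := isContractiveOn_extend θ h4
    refine ⟨_, _, fun x hx => ?_, ?_, h3'.mono (Finset.subset_insert _ _),
      h4'.mono (Finset.subset_insert _ _), fun x => ?_, fun x => ?_⟩
    · have hx' : x ∈ insert x₀ S := Finset.mem_insert_of_mem hx
      simp only [hx', dif_pos]
      exact h1 ⟨x, hx'⟩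
    · simp [h2]
    · by_cases hx : x ∈ insert x₀ S
      · exact h3'.norm_le_one hx₀ hx
      · simp only [hx, dif_neg, not_false_eq_true, norm_zero, zero_le_one]
    · by_cases hx : x ∈ insert x₀ S
      · exact h4'.norm_le_one hx₀ hx
      · simp only [hx, dif_neg, not_false_eq_true, norm_zero, zero_le_one]
  choose η θ h1 h2 h3 h4 h5 h6 using hfin
  let l : Ultrafilter (Finset X) := Ultrafilter.of atTop
  have hl : (l : Filter (Finset X)) ≤ atTop := Ultrafilter.of_le _
  have hev : ∀ S : Finset X, ∀ᶠ T in (l : Filter (Finset X)), S ⊆ T := fun S =>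
    hl (eventually_ge_atTop S)
  obtain ⟨η', hη⟩ := exists_tendsto_ultrafilter l η h5
  obtain ⟨θ', hθ⟩ := exists_tendsto_ultrafilter l θ h6
  refine ⟨η', θ', fun x => ?_, ?_, fun S => ?_, fun S => ?_⟩
  · refine tendsto_nhds_unique ((hη x).congr' ?_) (((hθ x).const_sub 1).const_mul _)
    filter_upwards [hev {x}] with T hT
    exact h1 T x (by simpa using hT)
  · refine tendsto_nhds_unique (hθ x₀) ?_
    simp only [h2]
    exact tendsto_const_nhds
  · exact isContractiveOn_of_tendsto hη ((hev S).mono fun T hT => (h3 T).mono hT)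
  · exact isContractiveOn_of_tendsto hθ ((hev S).mono fun T hT => (h4 T).mono hT)

/-- The map `k(·,x) ↦ η(x) k(·,x)` extends by density to a contraction, whose adjoint multiplies by
`conj η`. -/
theorem exists_mult_of_isContractiveOn {η : X → ℂ} (hη : ∀ S, IsContractiveOn H η S) :
    ∃ φ : Mult H, (∀ x, (φ : X → ℂ) x = conj (η x)) ∧ ∀ f, ‖mulOp φ f‖ ≤ ‖f‖ := by
  let e : (X →₀ ℂ) →ₗ[ℂ] H := Finsupp.linearCombination ℂ (kerVec H)
  let D : (X →₀ ℂ) →ₗ[ℂ] H := Finsupp.linearCombination ℂ fun x => η x • kerVec H x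
  have hdense : DenseRange e := by
    have h1 : Set.range e = (Submodule.span ℂ (Set.range (kerVec H)) : Set H) := by
      rw [← Finsupp.range_linearCombination]
      rfl
    rw [DenseRange, h1, Submodule.dense_iff_topologicalClosure_eq_top, ← top_le_iff,
      ← RKHS.kerFun_dense (𝕜 := ℂ) H]
    refine Submodule.topologicalClosure_mono (Submodule.span_le.2 ?_)
    rintro _ ⟨x, v, rfl⟩
    have : RKHS.kerFun H x v = v • kerVec H x := by
      rw [kerVec, ← map_smul, smul_eq_mul, mul_one]
    rw [this]
    exact Submodule.smul_mem _ _ (Submodule.subset_span ⟨x, rfl⟩)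
  have hnorm : ∀ c, ‖D c‖ ≤ 1 * ‖e c‖ := by
    intro c
    rw [one_mul]
    simpa only [D, e, Finsupp.linearCombination_apply, Finsupp.sum, smul_smul] using hη c.support c
  let T : H →L[ℂ] H := D.extendOfNorm e
  have hT : ∀ x, T (kerVec H x) = η x • kerVec H x := by
    intro x
    have := LinearMap.extendOfNorm_eq hdense ⟨1, hnorm⟩ (Finsupp.single x (1 : ℂ))
    simpa [e, D] using this
  have hT1 : ‖T‖ ≤ 1 := LinearMap.opNorm_extendOfNorm_le hdense zero_le_one hnorm
  have hadj : ∀ f x, T.adjoint f x = conj (η x) * f x := by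
    intro f x
    rw [← inner_kerVec_left, ContinuousLinearMap.adjoint_inner_right, hT, inner_smul_left,
      inner_kerVec_left]
  let φ : Mult H := ⟨fun x => conj (η x), fun f => ⟨T.adjoint f, funext fun x => hadj f x⟩⟩
  refine ⟨φ, fun x => rfl, fun f => ?_⟩
  have h1 : mulOp φ f = T.adjoint f := RKHS.ext fun x => by rw [mulOp_apply_apply, hadj]
  have h2 : ‖T.adjoint‖ ≤ 1 := by simpa using hT1
  rw [h1]
  exact (T.adjoint.le_of_opNorm_le h2 f).trans_eq (one_mul _)

/-- A vector fixed by the adjoint of a contraction is fixed by the contraction, so `(ψ - 1) h = 0`.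
If `ψ(x) = 1`, the same applies to `k(·,x)`, and evaluation at `x₀` gives `0 = 1`. -/
theorem eq_zero_of_inner_mulOp_eq {x₀ : X} (hx₀ : ∀ x, ker H x x₀ = 1) {ψ : Mult H}
    (hψ : ∀ f, ‖mulOp ψ f‖ ≤ ‖f‖) (hψ₀ : (ψ : X → ℂ) x₀ = 0) {h : H}
    (hh : ∀ g, ⟪h, mulOp ψ g⟫_ℂ = ⟪h, g⟫_ℂ) : h = 0 := by
  have hfix : ∀ h : H, (∀ g, ⟪h, mulOp ψ g⟫_ℂ = ⟪h, g⟫_ℂ) → mulOp ψ h = h := by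
    intro h hh
    rw [← sub_eq_zero, ← norm_eq_zero, ← sq_eq_zero_iff]
    refine le_antisymm ?_ (sq_nonneg _)
    rw [norm_sub_rev, norm_sub_sq (𝕜 := ℂ), hh, inner_self_eq_norm_sq]
    have h1 : ‖mulOp ψ h‖ ^ 2 ≤ ‖h‖ ^ 2 := by gcongr; exact hψ h
    linarith
  have hne : ∀ x, (ψ : X → ℂ) x ≠ 1 := by
    intro x hx
    have h1 := hfix (kerVec H x) fun g => by
      rw [inner_kerVec_left, inner_kerVec_left, mulOp_apply_apply, hx, one_mul]
    have h2 := congrArg (fun f : H => f x₀) h1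
    simp only [mulOp_apply_apply, hψ₀, zero_mul, kerVec_apply] at h2
    rw [← conj_ker, hx₀] at h2
    simp at h2
  refine RKHS.ext fun x => ?_
  have h1 := congrArg (fun f : H => f x) (hfix h hh)
  simp only [mulOp_apply_apply] at h1
  rw [RKHS.coe_zero, Pi.zero_apply]
  have h2 : ((ψ : X → ℂ) x - 1) * h x = 0 := by linear_combination h1
  exact (mul_eq_zero.1 h2).resolve_left (sub_ne_zero.2 (hne x))

/-- Every function in a normalized complete Pick space is a quotient of multipliers `φ / (1 - ψ)`
with `ψ` contractive and vanishing at the normalization point. -/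
theorem IsCompletePick.exists_mult_eq_mul_one_sub (hP : IsCompletePick H) {x₀ : X}
    (hx₀ : ∀ x, ker H x x₀ = 1) (f : H) :
    ∃ φ ψ : Mult H, (φ : X → ℂ) = (1 - ψ : Mult H) * ⇑f ∧ (ψ : X → ℂ) x₀ = 0 ∧
      ∀ g, ‖mulOp ψ g‖ ≤ ‖g‖ := by
  -- Adding `1` keeps `t` nonzero when `f = 0`.
  set t : ℝ := ‖f‖ + 1 with ht
  have ht0 : 0 < t := by positivity
  have htC : (t : ℂ) ≠ 0 := by exact_mod_cast ht0.ne'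
  obtain ⟨η, θ, h1, h2, h3, h4⟩ := hP.exists_factorization hx₀ ((t⁻¹ : ℂ) • f) (by
    rw [norm_smul, norm_inv, Complex.norm_real, Real.norm_of_nonneg ht0.le,
      inv_mul_le_iff₀ ht0]
    linarith)
  obtain ⟨φ, hφ, -⟩ := exists_mult_of_isContractiveOn h3
  obtain ⟨ψ, hψ, hψ'⟩ := exists_mult_of_isContractiveOn h4
  refine ⟨(t : ℂ) • φ, ψ, funext fun x => ?_, by rw [hψ, h2, map_zero], hψ'⟩
  have : ((1 - ψ : Mult H) : X → ℂ) x = 1 - conj (θ x) := by rw [← hψ]; rfl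
  rw [Pi.mul_apply, this]
  change (t : ℂ) * (φ : X → ℂ) x = _
  rw [hφ, h1, RKHS.coe_smul]
  simp only [Pi.smul_apply, smul_eq_mul, map_mul, map_inv₀, Complex.conj_ofReal, map_sub, map_one,
    Complex.conj_conj]
  field_simp

end

end PickSpace

/-! ### The equivalence -/

open PickSpace in
theorem corollary1p3 {X : Type*} {H : Type*} [NormedAddCommGroup H] [InnerProductSpace ℂ H]
    [CompleteSpace H] [RKHS ℂ H X ℂ] (hN : PickSpace.IsNormalized H)
    (hP : PickSpace.IsCompletePick H) (ρ : H →L[ℂ] ℂ) (hρ : ρ ≠ 0) :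
    (∀ (φ : PickSpace.Mult H) (g : H),
        ρ (PickSpace.mulOp φ g) = ρ (PickSpace.multToSpace hN φ) * ρ g) ↔
      (∀ f g h : H, (h : X → ℂ) = (f : X → ℂ) * (g : X → ℂ) → ρ h = ρ f * ρ g) := by
  refine ⟨fun hρm f g h hfg => ?_, fun hρm φ g => hρm _ _ _ ?_⟩
  · obtain ⟨x₀, hx₀⟩ := id hN
    obtain ⟨φ, ψ, hφ, hψ₀, hψ⟩ := hP.exists_mult_eq_mul_one_sub hx₀ f
    have h1 : mulOp (1 - ψ) h = mulOp φ g := RKHS.ext fun x => by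
      rw [mulOp_apply_apply, mulOp_apply_apply, hfg, hφ, Pi.mul_apply, Pi.mul_apply, mul_assoc]
    have h2 : multToSpace hN φ = mulOp (1 - ψ) f := RKHS.ext fun x => by
      rw [coe_multToSpace, hφ, coe_mulOp]
    have hne : ρ (multToSpace hN (1 - ψ)) ≠ 0 := by
      intro h0
      refine hρ ?_
      have h3 : ∀ k, ρ (mulOp (1 - ψ) k) = 0 := fun k => by rw [hρm, h0, zero_mul]
      have h4 : ∀ k, ρ (mulOp ψ k) = ρ k := by
        intro k
        have : mulOp (1 - ψ) k = k - mulOp ψ k := RKHS.ext fun x => by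
          rw [mulOp_apply_apply, RKHS.coe_sub, Pi.sub_apply, mulOp_apply_apply]
          change (1 - (ψ : X → ℂ) x) * k x = _
          ring
        have h5 := h3 k
        rw [this, map_sub, sub_eq_zero] at h5
        exact h5.symm
      -- The Riesz vector of `ρ` is fixed by the adjoint of multiplication by `ψ`.
      have h6 := eq_zero_of_inner_mulOp_eq hx₀ hψ hψ₀ (h := (InnerProductSpace.toDual ℂ H).symm ρ)
        fun k => by simpa only [InnerProductSpace.toDual_symm_apply] using h4 k
      simpa using h6
    apply mul_left_cancel₀ hne
    rw [← hρm, h1, hρm, h2, hρm, mul_assoc]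
  · rw [coe_mulOp, coe_multToSpace]
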